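/- All graphs are finite and simple. A \emph{cover} of a graph $G$ is a pair $\mathcal{H}=(L,H)$ of a graph $H$ and a map $L$ assigning to each $u\in V(G)$ a set $L(u)\subseteq V(H)$, such that the sets $L(u)$ partition $V(H)$, each $L(u)$ is a clique of $H$, every edge of $H$ between distinct sets $L(u)$ and $L(v)$ satisfies $uv\in E(G)$, and for each $uv\in E(G)$ the edges of $H$ between $L(u)$ and $L(v)$ form a (possibly empty, not necessarily perfect) matching. The cover is \emph{$k$-fold} if $|L(u)|=k$ for all $u$. For $\eta\in[0,1]$, an \emph{$(\eta,\mathcal{H})$-coloring} of $G$ is a set $S\subseteq V(H)$ such that $H$ has no edge between $S\cap L(u)$ and $S\cap L(v)$ for distinct $u,v$, and $|S\cap L(u)|\ge \eta|L(u)|$ for all $u\in V(G)$. Let $$\theta_{DP}(G,k)=\max\{\eta\in[0,1] : G \text{ has an } (\eta,\mathcal{H})\text{-coloring for every } k\text{-fold cover } \mathcal{H} \text{ of } G\},$$ $$\chi^*_{DP}(G)=\inf\{\theta_{DP}(G,k)^{-1} : k\in\mathbb{N},\ k\ge 1\},$$ where $0^{-1}=\infty$. \textbf{Theorem.} There is a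 function $\varepsilon\colon\mathbb{N}\to\mathbb{R}$ with $\varepsilon(d)\to 0$ as $d\to\infty$ such that the following holds for every integer $d\ge 2$. Suppose that a graph $G$ has an acyclic orientation $D$ such that (D1) the maximum out-degree of $D$ is at most $d$; and (D2) for every arc $uv$ of $D$, there is no directed path from $u$ to $v$ of even length in $D$. Then $$\chi^*_{DP}(G)\le (1+\varepsilon(d))\,\frac{d}{\ln d}.$$ -/

import Mathlib

open Filter Topology

universe u

/-- A cover `(L, H)` of a graph `G`, where the graph `H` has vertex set `W`. -/
structure DPCover {V : Type u} (G : SimpleGraph V) (W : Type u) where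
  /-- The graph `H` of the cover. -/
  H : SimpleGraph W
  /-- The list of each vertex. -/
  L : V → Set W
  /-- The lists partition the vertex set of `H`. -/
  partition : ∀ x : W, ∃! v : V, x ∈ L v
  /-- Every list induces a complete subgraph. -/
  clique : ∀ v : V, H.IsClique (L v)
  /-- Edges between different lists lie over edges of `G`. -/
  edge_over : ∀ v w : V, ∀ x ∈ L v, ∀ y ∈ L w, H.Adj x y → v = w ∨ G.Adj v w
  /-- The edges between two adjacent lists form a (not necessarily perfect) matching: no vertex of
  `L v` has two neighbors in `L w`. As `G.Adj` is symmetric, the same holds with the roles of `v`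
  and `w` exchanged. -/
  matching : ∀ v w : V, G.Adj v w →
    ∀ x ∈ L v, ∀ y ∈ L w, ∀ z ∈ L w, H.Adj x y → H.Adj x z → y = z

namespace DPCover

variable {V W : Type u} {G : SimpleGraph V}

/-- All lists have size `k`. -/
def IsFold (C : DPCover G W) (k : ℕ) : Prop :=
  ∀ v : V, (C.L v).ncard = k

/-- `S` spans no cross-edge, i.e. no edge of `H` between different lists. -/
def QuasiIndependent (C : DPCover G W) (S : Set W) : Prop :=
  ∀ v w : V, v ≠ w → ∀ x ∈ S ∩ C.L v, ∀ y ∈ S ∩ C.L w, ¬ C.H.Adj x y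

/-- `S` is an `(η, H)`-coloring. -/
def IsColoring (C : DPCover G W) (η : ℝ) (S : Set W) : Prop :=
  C.QuasiIndependent S ∧ ∀ v : V, η * ((C.L v).ncard : ℝ) ≤ ((S ∩ C.L v).ncard : ℝ)

end DPCover

/-- The numbers `η ∈ [0,1]` such that `G` has an `(η, H)`-coloring for every `k`-fold cover. -/
def dpRatios {V : Type u} (G : SimpleGraph V) (k : ℕ) : Set ℝ :=
  {η : ℝ | η ∈ Set.Icc (0 : ℝ) 1 ∧
    ∀ (W : Type u) [Finite W] (C : DPCover G W), C.IsFold k → ∃ S : Set W, C.IsColoring η S}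

/-- The quantity `θ_DP(G, k)`. The supremum is a maximum, see `isGreatest_thetaDP`. -/
noncomputable def thetaDP {V : Type u} (G : SimpleGraph V) (k : ℕ) : ℝ :=
  sSup (dpRatios G k)

theorem isGreatest_thetaDP {V : Type u} (G : SimpleGraph V) (k : ℕ) :
    IsGreatest (dpRatios G k) (thetaDP G k) := by
  have hne : (dpRatios G k).Nonempty :=
    ⟨0, ⟨le_rfl, zero_le_one⟩, fun W _ C _ =>
      ⟨∅, fun v w _ x hx => absurd hx.1 (Set.notMem_empty x), fun v => by simp⟩⟩
  have hbd : BddAbove (dpRatios G k) := ⟨1, fun η h => h.1.2⟩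
  have hcl : IsClosed (dpRatios G k) := by
    have : dpRatios G k = Set.Icc (0 : ℝ) 1 ∩
        ⋂ (W : Type u) (_ : Finite W) (C : DPCover G W) (_ : C.IsFold k),
          ⋃ S : Set W, {η : ℝ | C.IsColoring η S} := by
      ext η
      simp [dpRatios]
    rw [this]
    refine isClosed_Icc.inter (isClosed_iInter fun W => isClosed_iInter fun _ =>
      isClosed_iInter fun C => isClosed_iInter fun _ => isClosed_iUnion_of_finite fun S => ?_)
    simp only [DPCover.IsColoring, Set.ofPred_and, Set.ofPred_forall]
    exact isClosed_const.inter (isClosed_iInter fun v =>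
      isClosed_le (continuous_id.mul continuous_const) continuous_const)
  exact ⟨hcl.csSup_mem hne hbd, fun η h => le_csSup hbd h⟩

/-- The fractional DP-chromatic number, `inf {θ_DP(G, k)⁻¹ : k ≥ 1}`. It is taken in `[0, ∞]`, so
that `θ_DP(G, k)⁻¹ = ∞` when `θ_DP(G, k) = 0`. -/
noncomputable def fracDPChromaticNumber {V : Type u} (G : SimpleGraph V) : ENNReal :=
  ⨅ (k : ℕ) (_ : 1 ≤ k), (ENNReal.ofReal (thetaDP G k))⁻¹

namespace Digraph

variable {V : Type u}

/-- `D` arises from `G` by giving each edge exactly one of its two directions. -/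
def IsOrientationOf (D : Digraph V) (G : SimpleGraph V) : Prop :=
  (∀ v w : V, G.Adj v w ↔ D.Adj v w ∨ D.Adj w v) ∧ ∀ v w : V, D.Adj v w → ¬ D.Adj w v

/-- There are no directed cycles: no vertex is reachable from itself by a directed walk of positive
length. -/
def IsAcyclic (D : Digraph V) : Prop :=
  ∀ v : V, ¬ Relation.TransGen D.Adj v v

/-- There is a directed path from `v` to `w` of length `n` (with `n` arcs). -/
def HasDirectedPath (D : Digraph V) (v w : V) (n : ℕ) : Prop :=
  ∃ p : Fin (n + 1) → V, Function.Injective p ∧ p 0 = v ∧ p (Fin.last n) = w ∧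
    ∀ i : Fin n, D.Adj (p i.castSucc) (p i.succ)

end Digraph

/-! Orient the cross-edges of a cover along `D` and process the vertices of `H` from the sinks up.
Select `x` when an independent coin of bias `p x` succeeds and no out-neighbor of `x` is selected.
The selected set spans no cross-edge. If every vertex is selected with the same probability `q`, a
list of size `k` holds `q * k` selected vertices on average. Each vertex is correlated with a number
of others bounded in terms of `|V|` alone, so for `k` large the second moment method gives one
outcome that is good for all lists at once. Every `η < q` is then attained
(`exists_isColoring_of_large_fold`).

How large can `q` be? With biases at most `P`, it suffices that each `x` is free (has no selected
out-neighbor) with probability at least `q / P`. The heart is `exp_le_bernExp_freeInd`: this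
probability is at least `exp (-(d * q / (1 - P)))`, almost as if the out-neighbors were selected
independently. Freeness of `x` is a product over out-neighbors `y` of one minus coin times `g y`,
where `g y` is the freeness of `y` after all coins at out-neighbors of `x` are switched off.
Averaging these coins and applying Jensen leaves only `p y * E (g y) ≤ q` to show. By (D2), walks
between out-neighbors of `x` have even length, and coins met only along even walks favor selection.
Switching them off therefore cannot make `y` freer, and `p y * E (g y)` is at most the probability
`q` that `y` is selected. A small constant `P` then allows `q` close to `log d / d`. -/

/-! ### Expectation over independent biased coins -/

section BernoulliExpectation

variable {W : Type*} [Fintype W] [DecidableEq W]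

/-- The expectation of `f` under independent coins, where the coin at `x` is `true` with
probability `p x`. -/
noncomputable def bernExp (p : W → ℝ) (f : (W → Bool) → ℝ) : ℝ :=
  ∑ ω, (∏ x, if ω x then p x else 1 - p x) * f ω

theorem bernExp_add (p : W → ℝ) (f g : (W → Bool) → ℝ) :
    bernExp p (fun ω => f ω + g ω) = bernExp p f + bernExp p g := by
  simp only [bernExp, mul_add, Finset.sum_add_distrib]

theorem bernExp_const_mul (p : W → ℝ) (c : ℝ) (f : (W → Bool) → ℝ) :
    bernExp p (fun ω => c * f ω) = c * bernExp p f := by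
  simp only [bernExp, Finset.mul_sum]
  exact Finset.sum_congr rfl fun ω _ => by ring

theorem bernExp_sub (p : W → ℝ) (f g : (W → Bool) → ℝ) :
    bernExp p (fun ω => f ω - g ω) = bernExp p f - bernExp p g := by
  simp only [bernExp, mul_sub, Finset.sum_sub_distrib]

theorem bernExp_sum {ι : Type*} (p : W → ℝ) (s : Finset ι) (f : ι → (W → Bool) → ℝ) :
    bernExp p (fun ω => ∑ i ∈ s, f i ω) = ∑ i ∈ s, bernExp p (f i) := by
  simp only [bernExp, Finset.mul_sum]
  exact Finset.sum_comm

theorem bernExp_one (p : W → ℝ) : bernExp p (fun _ => 1) = 1 := by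
  have h := Finset.prod_univ_sum (fun _ : W => (Finset.univ : Finset Bool))
    (fun x b => if b then p x else 1 - p x)
  simp only [Fintype.piFinset_univ] at h
  simp only [bernExp, mul_one]
  rw [← h]
  simp

theorem bernExp_const (p : W → ℝ) (c : ℝ) : bernExp p (fun _ => c) = c := by
  simpa [bernExp_one] using bernExp_const_mul p c (fun _ => 1)

theorem bernExp_mono {p : W → ℝ} (h0 : ∀ x, 0 ≤ p x) (h1 : ∀ x, p x ≤ 1)
    {f g : (W → Bool) → ℝ} (h : ∀ ω, f ω ≤ g ω) : bernExp p f ≤ bernExp p g := by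
  refine Finset.sum_le_sum fun ω _ => mul_le_mul_of_nonneg_left (h ω)
    (Finset.prod_nonneg fun x _ => ?_)
  split_ifs
  · exact h0 x
  · exact sub_nonneg.2 (h1 x)

theorem bernExp_split (p : W → ℝ) (f : (W → Bool) → ℝ) (y : W) :
    bernExp p f = ∑ ω : {j // j ≠ y} → Bool, (∏ j, if ω j then p j else 1 - p j) *
      (p y * f ((Equiv.funSplitAt y Bool).symm (true, ω)) +
        (1 - p y) * f ((Equiv.funSplitAt y Bool).symm (false, ω))) := by
  have key : ∀ (b : Bool) (ω : {j // j ≠ y} → Bool),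
      (∏ x, if ((Equiv.funSplitAt y Bool).symm (b, ω)) x then p x else 1 - p x) =
        (if b then p y else 1 - p y) * ∏ j, if ω j then p j else 1 - p j := by
    intro b ω
    rw [Fintype.prod_eq_mul_prod_subtype_ne _ y]
    congr 1
    · simp
    · refine Finset.prod_congr rfl fun j _ => ?_
      have : j.1 ≠ y := j.2
      simp [this]
  unfold bernExp
  rw [← (Equiv.funSplitAt y Bool).symm.sum_comp, Fintype.sum_prod_type, Fintype.sum_bool,
    ← Finset.sum_add_distrib]
  refine Finset.sum_congr rfl fun ω _ => ?_
  rw [key, key]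
  simp only [if_true, Bool.false_eq_true, if_false]
  ring

theorem apply_funSplitAt_symm {X : Type*} [DecidableEq X] {f : (X → Bool) → ℝ} {y : X}
    (hf : DependsOn f {y}ᶜ) (ω : {j // j ≠ y} → Bool) (b c : Bool) :
    f ((Equiv.funSplitAt y Bool).symm (b, ω)) = f ((Equiv.funSplitAt y Bool).symm (c, ω)) := by
  apply hf
  intro j hj
  have : j ≠ y := hj
  simp [this]

/-- A function not involving the coin at `y` is independent of it. -/
theorem bernExp_coin_mul (p : W → ℝ) {h : (W → Bool) → ℝ} {y : W} (hh : DependsOn h {y}ᶜ) :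
    bernExp p (fun ω => (if ω y then 1 else 0) * h ω) = p y * bernExp p h := by
  rw [bernExp_split p _ y, bernExp_split p h y, Finset.mul_sum]
  refine Finset.sum_congr rfl fun ω _ => ?_
  rw [apply_funSplitAt_symm hh ω false true]
  simp
  ring

theorem bernExp_update (p : W → ℝ) {f : (W → Bool) → ℝ} {y : W} (hf : DependsOn f {y}ᶜ) (c : ℝ) :
    bernExp (Function.update p y c) f = bernExp p f := by
  rw [bernExp_split _ f y, bernExp_split p f y]
  refine Finset.sum_congr rfl fun ω _ => ?_
  rw [apply_funSplitAt_symm hf ω false true]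
  have : ∀ j : {j // j ≠ y}, Function.update p y c j = p j := fun j =>
    Function.update_of_ne j.2 _ _
  simp only [this, Function.update_self]
  ring

/-- Condition on the coins of `A` one at a time until `f` is constant. -/
theorem bernExp_mul_of_dependsOn (p : W → ℝ) (A : Finset W) :
    ∀ {f g : (W → Bool) → ℝ}, DependsOn f (A : Set W) → DependsOn g (A : Set W)ᶜ →
      bernExp p (fun ω => f ω * g ω) = bernExp p f * bernExp p g := by
  induction A using Finset.induction_on with
  | empty =>
    intro f g hf _
    have hc : ∀ ω, f ω = f (fun _ => false) := fun ω => hf (by simp)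
    simp only [hc]
    rw [bernExp_const_mul, funext hc, bernExp_const]
  | insert a A ha ih =>
    intro f g hf hg
    have hdep : ∀ b, DependsOn (fun ω => f (Function.update ω a b)) (A : Set W) := by
      intro b ω ω' h
      refine hf fun i hi => ?_
      by_cases hia : i = a
      · subst hia; simp
      · rw [Function.update_of_ne hia, Function.update_of_ne hia]
        exact h i (by simpa [hia] using hi)
    have hdep' : ∀ b, DependsOn (fun ω => f (Function.update ω a b)) {a}ᶜ := by
      intro b ω ω' h
      exact hdep b fun i hi => h i fun hia => ha (by rw [← Set.mem_singleton_iff.1 hia]; exact hi)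
    have hgA : DependsOn g (A : Set W)ᶜ := fun ω ω' h =>
      hg fun i hi => h i fun hiA => hi (by simp [Finset.mem_coe.1 hiA])
    have hga : DependsOn g {a}ᶜ := fun ω ω' h =>
      hg fun i hi => h i fun hia => hi (by simp [Set.mem_singleton_iff.1 hia])
    have expand : ∀ h : (W → Bool) → ℝ, DependsOn h {a}ᶜ →
        bernExp p (fun ω => f ω * h ω) =
          p a * bernExp p (fun ω => f (Function.update ω a true) * h ω) +
          (1 - p a) * bernExp p (fun ω => f (Function.update ω a false) * h ω) := by
      intro h hh
      have hd : ∀ b, DependsOn (fun ω => f (Function.update ω a b) * h ω) {a}ᶜ := by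
        intro b ω ω' hω
        have h1 := hdep' b hω
        have h2 := hh hω
        simp only at h1 ⊢
        rw [h1, h2]
      have e : (fun ω => f ω * h ω) = fun ω =>
          (if ω a then 1 else 0) * (f (Function.update ω a true) * h ω) +
          (f (Function.update ω a false) * h ω -
            (if ω a then 1 else 0) * (f (Function.update ω a false) * h ω)) := by
        funext ω
        cases hω : ω a
        · have : Function.update ω a false = ω := by rw [← hω]; exact Function.update_eq_self a ω
          simp [this]
        · have : Function.update ω a true = ω := by rw [← hω]; exact Function.update_eq_self a ω
          simp [this]
      rw [e, bernExp_add, bernExp_sub, bernExp_coin_mul p (hd true), bernExp_coin_mul p (hd false)]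
      ring
    have h1 := expand g hga
    have h2 := expand (fun _ => 1) (fun _ _ _ => rfl)
    simp only [mul_one] at h2
    rw [h1, h2, ih (hdep true) hgA, ih (hdep false) hgA]
    ring

/-- Each factor is affine in its own coin and all else is independent of that coin, so coins may be
replaced by their means one by one. The factor `h` absorbs, in the induction, the factor whose coin
is not yet averaged. -/
theorem bernExp_prod_one_sub_coin (p : W → ℝ) (Y : Finset W) (g : W → (W → Bool) → ℝ) :
    ∀ h : (W → Bool) → ℝ, DependsOn h (Y : Set W)ᶜ → (∀ y ∈ Y, DependsOn (g y) (Y : Set W)ᶜ) →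
      bernExp p (fun ω => h ω * ∏ y ∈ Y, (1 - (if ω y then 1 else 0) * g y ω)) =
        bernExp p (fun ω => h ω * ∏ y ∈ Y, (1 - p y * g y ω)) := by
  induction Y using Finset.induction_on with
  | empty => intro h _ _; simp
  | insert a Y ha ih =>
    intro h hh hg
    have sub : ∀ {f : (W → Bool) → ℝ}, DependsOn f (↑(insert a Y) : Set W)ᶜ →
        DependsOn f (Y : Set W)ᶜ := fun hf ω ω' hω =>
      hf fun i hi => hω i fun hiA => hi (by simp [Finset.mem_coe.1 hiA])
    have suba : ∀ {f : (W → Bool) → ℝ}, DependsOn f (↑(insert a Y) : Set W)ᶜ →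
        DependsOn f {a}ᶜ := fun hf ω ω' hω =>
      hf fun i hi => hω i fun hia => hi (by simp [Set.mem_singleton_iff.1 hia])
    have hgY : ∀ y ∈ Y, DependsOn (g y) (Y : Set W)ᶜ := fun y hy =>
      sub (hg y (Finset.mem_insert_of_mem hy))
    have hga := hg a (Finset.mem_insert_self a Y)
    have step1 := ih (fun ω => h ω * (1 - (if ω a then 1 else 0) * g a ω)) (by
      intro ω ω' hω
      have e1 := sub hh hω
      have e2 := sub hga hω
      have e3 := hω a (by simpa using ha)
      simp only
      rw [e1, e2, e3]) hgY
    have hd : DependsOn (fun ω => g a ω * (h ω * ∏ y ∈ Y, (1 - p y * g y ω))) {a}ᶜ := by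
      intro ω ω' hω
      have e1 := suba hh hω
      have e2 := suba hga hω
      have e3 : ∀ y ∈ Y, g y ω = g y ω' := fun y hy =>
        suba (hg y (Finset.mem_insert_of_mem hy)) hω
      simp only
      rw [e1, e2]
      congr 2
      exact Finset.prod_congr rfl fun y hy => by rw [e3 y hy]
    simp only [Finset.prod_insert ha, ← mul_assoc] at step1 ⊢
    rw [step1]
    have e1 : (fun ω => h ω * (1 - (if ω a then 1 else 0) * g a ω) * ∏ y ∈ Y, (1 - p y * g y ω)) =
        fun ω => h ω * ∏ y ∈ Y, (1 - p y * g y ω) -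
          (if ω a then 1 else 0) * (g a ω * (h ω * ∏ y ∈ Y, (1 - p y * g y ω))) := by
      funext ω; ring
    have e2 : (fun ω => h ω * (1 - p a * g a ω) * ∏ y ∈ Y, (1 - p y * g y ω)) =
        fun ω => h ω * ∏ y ∈ Y, (1 - p y * g y ω) -
          p a * (g a ω * (h ω * ∏ y ∈ Y, (1 - p y * g y ω))) := by
      funext ω; ring
    rw [e1, e2, bernExp_sub, bernExp_sub, bernExp_coin_mul p hd, bernExp_const_mul]

/-- Jensen's inequality for the exponential function. -/
theorem exp_bernExp_le {p : W → ℝ} (h0 : ∀ x, 0 ≤ p x) (h1 : ∀ x, p x ≤ 1)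
    (f : (W → Bool) → ℝ) :
    Real.exp (bernExp p f) ≤ bernExp p (fun ω => Real.exp (f ω)) := by
  set m := bernExp p f with hm
  -- The exponential lies above its tangent line at the mean `m`.
  have key : bernExp p (fun ω => Real.exp m * ((1 - m) + f ω)) ≤
      bernExp p (fun ω => Real.exp (f ω)) := by
    refine bernExp_mono h0 h1 fun ω => ?_
    have : Real.exp (f ω) = Real.exp m * Real.exp (f ω - m) := by
      rw [← Real.exp_add]; congr 1; ring
    rw [this]
    refine mul_le_mul_of_nonneg_left ?_ (Real.exp_pos m).le
    linarith [Real.add_one_le_exp (f ω - m)]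
  rw [bernExp_const_mul, bernExp_add, bernExp_const, ← hm] at key
  linarith

theorem exists_lt_of_bernExp_lt {p : W → ℝ} (h0 : ∀ x, 0 ≤ p x) (h1 : ∀ x, p x ≤ 1)
    {f : (W → Bool) → ℝ} {c : ℝ} (h : bernExp p f < c) : ∃ ω, f ω < c := by
  by_contra! hc
  have := bernExp_mono h0 h1 hc
  rw [bernExp_const] at this
  linarith

/-- The second moment method: a sum of indicators of mean `q`, each of which is correlated with at
most `M` others, has variance at most `M` times the number of summands. -/
theorem bernExp_sq_sum_sub_le {p : W → ℝ} (h0 : ∀ x, 0 ≤ p x) (h1 : ∀ x, p x ≤ 1)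
    {ι : Type*} [DecidableEq ι] (s : Finset ι) (f : ι → (W → Bool) → ℝ) {q : ℝ} (hq0 : 0 ≤ q)
    (hq1 : q ≤ 1)
    (hf0 : ∀ i ω, 0 ≤ f i ω) (hf1 : ∀ i ω, f i ω ≤ 1) (hf : ∀ i ∈ s, bernExp p (f i) = q)
    (N : ι → Finset ι) {M : ℕ} (hM : ∀ i ∈ s, (N i).card ≤ M)
    (hN : ∀ i ∈ s, ∀ j ∈ s, j ∉ N i → bernExp p (fun ω => f i ω * f j ω) = q * q) :
    bernExp p (fun ω => (∑ i ∈ s, f i ω - s.card * q) ^ 2) ≤ s.card * M := by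
  have e : (fun ω => (∑ i ∈ s, f i ω - s.card * q) ^ 2) =
      fun ω => ∑ i ∈ s, ∑ j ∈ s, (f i ω - q) * (f j ω - q) := by
    funext ω
    rw [← Finset.sum_mul_sum, Finset.sum_sub_distrib, Finset.sum_const, nsmul_eq_mul, sq]
  rw [e, bernExp_sum, ← nsmul_eq_mul]
  refine Finset.sum_le_card_nsmul _ _ _ fun i hi => ?_
  -- Covariances vanish outside `N i`, and the at most `M` remaining ones are each at most 1.
  rw [bernExp_sum, ← Finset.sum_filter_add_sum_filter_not s (· ∈ N i)]
  have hz : ∑ j ∈ s with j ∉ N i, bernExp p (fun ω => (f i ω - q) * (f j ω - q)) = 0 := by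
    refine Finset.sum_eq_zero fun j hj => ?_
    rw [Finset.mem_filter] at hj
    have e2 : (fun ω => (f i ω - q) * (f j ω - q)) =
        fun ω => f i ω * f j ω - (q * f i ω + q * f j ω - q * q) := by
      funext ω; ring
    rw [e2, bernExp_sub, bernExp_sub, bernExp_add, bernExp_const_mul, bernExp_const_mul,
      bernExp_const, hN i hi j hj.1 hj.2, hf i hi, hf j hj.1]
    ring
  rw [hz, add_zero]
  calc ∑ j ∈ s with j ∈ N i, bernExp p (fun ω => (f i ω - q) * (f j ω - q))
      ≤ ({j ∈ s | j ∈ N i} : Finset ι).card • (1 : ℝ) := by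
        refine Finset.sum_le_card_nsmul _ _ _ fun j _ => ?_
        calc _ ≤ bernExp p (fun _ => 1) := bernExp_mono h0 h1 fun ω => by
              have hi0 := hf0 i ω
              have hi1 := hf1 i ω
              have hj0 := hf0 j ω
              have hj1 := hf1 j ω
              have := abs_le.2 (⟨by linarith, by linarith⟩ : -1 ≤ f i ω - q ∧ f i ω - q ≤ 1)
              have := abs_le.2 (⟨by linarith, by linarith⟩ : -1 ≤ f j ω - q ∧ f j ω - q ≤ 1)
              calc (f i ω - q) * (f j ω - q) ≤ |f i ω - q| * |f j ω - q| := by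
                    rw [← abs_mul]; exact le_abs_self _
                _ ≤ 1 := mul_le_one₀ ‹_› (abs_nonneg _) ‹_›
          _ = 1 := bernExp_one p
    _ ≤ M := by
        rw [nsmul_eq_mul, mul_one]
        exact_mod_cast (Finset.card_le_card fun j hj => (Finset.mem_filter.1 hj).2).trans (hM i hi)

end BernoulliExpectation
-- Take reciprocals: `1 / (1 - t) = 1 + t / (1 - t) ≤ exp (t / (1 - t))`.
theorem exp_neg_div_le_one_sub {t P : ℝ} (h0 : 0 ≤ t) (h1 : t ≤ P) (hP : P < 1) :
    Real.exp (-(t / (1 - P))) ≤ 1 - t := by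
  have ht : 0 < 1 - t := by linarith
  have hP' : 0 < 1 - P := by linarith
  rw [Real.exp_neg, inv_le_comm₀ (Real.exp_pos _) ht]
  have e : (1 - t)⁻¹ = t / (1 - t) + 1 := by field_simp; ring
  rw [e]
  refine le_trans ?_ (Real.add_one_le_exp _)
  gcongr

/-! ### Random greedy selection along an acyclic orientation -/

section GreedySelection

variable {W : Type*} {out : W → Finset W} {r : W → ℕ}

/-- Going through the vertices in order of increasing rank, select `x` if its coin is `true` and no
out-neighbor of `x` has been selected. -/
def GreedySelected (hr : ∀ x, ∀ y ∈ out x, r y < r x) (ω : W → Bool) (x : W) : Prop :=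
  ω x = true ∧ ∀ y, (h : y ∈ out x) → ¬ GreedySelected hr ω y
termination_by r x
decreasing_by exact hr x y h

/-- No out-neighbor of `x` is selected. -/
def GreedyFree (hr : ∀ x, ∀ y ∈ out x, r y < r x) (ω : W → Bool) (x : W) : Prop :=
  ∀ y ∈ out x, ¬ GreedySelected hr ω y

theorem greedySelected_iff (hr : ∀ x, ∀ y ∈ out x, r y < r x) (ω : W → Bool) (x : W) :
    GreedySelected hr ω x ↔ ω x = true ∧ GreedyFree hr ω x := by
  rw [GreedySelected]; rfl

/-- There is a directed walk of length `n` from `x` to `y`. -/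
def OutWalk (out : W → Finset W) : ℕ → W → W → Prop
  | 0, x, y => x = y
  | n + 1, x, y => ∃ z ∈ out x, OutWalk out n z y

theorem greedySelected_congr (hr : ∀ x, ∀ y ∈ out x, r y < r x) {ω ω' : W → Bool} (x : W)
    (h : ∀ n y, OutWalk out n x y → ω y = ω' y) :
    GreedySelected hr ω x ↔ GreedySelected hr ω' x := by
  induction hn : r x using Nat.strong_induction_on generalizing x with
  | _ n ih =>
    subst hn
    rw [greedySelected_iff, greedySelected_iff, h 0 x rfl]
    refine and_congr_right fun _ => forall₂_congr fun y hy => not_congr ?_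
    exact ih _ (hr x y hy) y (fun n z hz => h (n + 1) z ⟨y, hy, hz⟩) rfl

theorem OutWalk.length_add_rank_le (hr : ∀ x, ∀ y ∈ out x, r y < r x) {n : ℕ} {x y : W}
    (h : OutWalk out n x y) : n + r y ≤ r x := by
  induction n generalizing x with
  | zero => obtain rfl : x = y := h; simp
  | succ n ih =>
    obtain ⟨z, hz, hw⟩ := h
    have := ih hw
    have := hr x z hz
    omega

theorem greedyFree_congr (hr : ∀ x, ∀ y ∈ out x, r y < r x) {ω ω' : W → Bool} (x : W)
    (h : ∀ y, y ≠ x → ω y = ω' y) : GreedyFree hr ω x ↔ GreedyFree hr ω' x := by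
  refine forall₂_congr fun y hy => not_congr (greedySelected_congr hr y fun n z hz => h z ?_)
  rintro rfl
  have := hz.length_add_rank_le hr
  have := hr z y hy
  omega

open Classical in
/-- The indicator of the event that `x` is selected. -/
noncomputable def selInd (hr : ∀ x, ∀ y ∈ out x, r y < r x) (x : W) (ω : W → Bool) : ℝ :=
  if GreedySelected hr ω x then 1 else 0

open Classical in
/-- The indicator of the event that no out-neighbor of `x` is selected. -/
noncomputable def freeInd (hr : ∀ x, ∀ y ∈ out x, r y < r x) (x : W) (ω : W → Bool) : ℝ :=
  if GreedyFree hr ω x then 1 else 0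

theorem selInd_eq (hr : ∀ x, ∀ y ∈ out x, r y < r x) (x : W) (ω : W → Bool) :
    selInd hr x ω = (if ω x then 1 else 0) * freeInd hr x ω := by
  unfold selInd freeInd
  rw [greedySelected_iff]
  by_cases h1 : ω x = true <;> by_cases h2 : GreedyFree hr ω x <;> simp [h1, h2]

theorem freeInd_dependsOn (hr : ∀ x, ∀ y ∈ out x, r y < r x) (x : W) :
    DependsOn (freeInd hr x) {x}ᶜ := by
  intro ω ω' h
  unfold freeInd
  rw [greedyFree_congr hr x fun y hy => h y hy]

theorem selInd_dependsOn (hr : ∀ x, ∀ y ∈ out x, r y < r x) (x : W) :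
    DependsOn (selInd hr x) {y | ∃ n, OutWalk out n x y} := by
  intro ω ω' h
  unfold selInd
  rw [greedySelected_congr hr x fun n y hy => h y ⟨n, hy⟩]

variable [DecidableEq W]

/-- Turn the coins in `Y` to `false`. -/
def clearCoins (Y : Finset W) (ω : W → Bool) (x : W) : Bool :=
  if x ∈ Y then false else ω x

/-- A coin reached only by even walks can only help `x`, one reached only by odd walks can only hurt
it. Passing to an out-neighbor flips both the parity and the direction of the implication, so the
two halves are proved together. -/
theorem greedySelected_clearCoins (hr : ∀ x, ∀ y ∈ out x, r y < r x) (Y : Finset W)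
    (ω : W → Bool) (x : W) :
    ((∀ y ∈ Y, ∀ n, OutWalk out n x y → Even n) →
      GreedySelected hr (clearCoins Y ω) x → GreedySelected hr ω x) ∧
    ((∀ y ∈ Y, ∀ n, OutWalk out n x y → ¬ Even n) →
      GreedySelected hr ω x → GreedySelected hr (clearCoins Y ω) x) := by
  induction hn : r x using Nat.strong_induction_on generalizing x with
  | _ n ih =>
    subst hn
    constructor
    · intro h hx
      rw [greedySelected_iff] at hx ⊢
      refine ⟨?_, fun y hy hsel => hx.2 y hy ((ih _ (hr x y hy) y rfl).2 ?_ hsel)⟩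
      · have := hx.1
        unfold clearCoins at this
        split_ifs at this
        exact this
      · intro z hz n hw
        have := h z hz (n + 1) ⟨y, hy, hw⟩
        rwa [Nat.even_add_one] at this
    · intro h hx
      rw [greedySelected_iff] at hx ⊢
      refine ⟨?_, fun y hy hsel => hx.2 y hy ((ih _ (hr x y hy) y rfl).1 ?_ hsel)⟩
      · have : x ∉ Y := fun hxY => h x hxY 0 rfl Even.zero
        unfold clearCoins
        rw [if_neg this]
        exact hx.1
      · intro z hz n hw
        have := h z hz (n + 1) ⟨y, hy, hw⟩
        rwa [Nat.even_add_one, not_not] at this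

theorem greedyFree_of_clearCoins (hr : ∀ x, ∀ y ∈ out x, r y < r x) (Y : Finset W)
    (ω : W → Bool) (x : W) (h : ∀ y ∈ Y, ∀ n, OutWalk out n x y → Even n)
    (hx : GreedyFree hr (clearCoins Y ω) x) : GreedyFree hr ω x := by
  refine fun y hy hsel => hx y hy ((greedySelected_clearCoins hr Y ω y).2 ?_ hsel)
  intro z hz n hw
  have := h z hz (n + 1) ⟨y, hy, hw⟩
  rwa [Nat.even_add_one] at this

/-- Under either condition the coins in `Y` have no effect, and induction on rank shows that
clearing them leaves the whole selection unchanged. The gain is that the cleared freeness events are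
independent of the coins in `Y`. -/
theorem forall_not_greedySelected_iff (hr : ∀ x, ∀ y ∈ out x, r y < r x) (Y : Finset W)
    (ω : W → Bool) :
    (∀ y ∈ Y, ¬ GreedySelected hr ω y) ↔
      ∀ y ∈ Y, ¬ (ω y = true ∧ GreedyFree hr (clearCoins Y ω) y) := by
  constructor
  · intro h
    have key : ∀ x, GreedySelected hr (clearCoins Y ω) x ↔ GreedySelected hr ω x := by
      intro x
      induction hn : r x using Nat.strong_induction_on generalizing x with
      | _ n ih =>
        subst hn
        by_cases hx : x ∈ Y
        · refine iff_of_false (fun hs => ?_) (h x hx)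
          have := ((greedySelected_iff hr _ x).1 hs).1
          simp [clearCoins, hx] at this
        · rw [greedySelected_iff, greedySelected_iff]
          refine and_congr (by simp [clearCoins, hx]) ?_
          exact forall₂_congr fun y hy => not_congr (ih _ (hr x y hy) y rfl)
    intro y hy hf
    refine h y hy ((greedySelected_iff hr ω y).2 ⟨hf.1, ?_⟩)
    exact fun z hz hs => hf.2 z hz ((key z).2 hs)
  · intro h
    have key : ∀ x, GreedySelected hr (clearCoins Y ω) x ↔ GreedySelected hr ω x := by
      intro x
      induction hn : r x using Nat.strong_induction_on generalizing x with
      | _ n ih =>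
        subst hn
        have hfree : GreedyFree hr (clearCoins Y ω) x ↔ GreedyFree hr ω x :=
          forall₂_congr fun y hy => not_congr (ih _ (hr x y hy) y rfl)
        rw [greedySelected_iff, greedySelected_iff]
        by_cases hx : x ∈ Y
        · refine iff_of_false (fun hs => ?_) (fun hs => h x hx ⟨hs.1, hfree.2 hs.2⟩)
          simp [clearCoins, hx] at hs
        · exact and_congr (by simp [clearCoins, hx]) hfree
    intro y hy hs
    have := ((greedySelected_iff hr _ y).1 ((key y).2 hs)).1
    simp [clearCoins, hy] at this

theorem freeInd_eq_prod (hr : ∀ x, ∀ y ∈ out x, r y < r x) (x : W) (ω : W → Bool) :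
    freeInd hr x ω =
      ∏ y ∈ out x, (1 - (if ω y then 1 else 0) * freeInd hr y (clearCoins (out x) ω)) := by
  have hiff := forall_not_greedySelected_iff hr (out x) ω
  by_cases h : GreedyFree hr ω x
  · have h' := hiff.1 h
    rw [Finset.prod_eq_one]
    · simp [freeInd, h]
    · intro y hy
      have := h' y hy
      by_cases h1 : ω y = true
      · have h2 : ¬ GreedyFree hr (clearCoins (out x) ω) y := fun h2 => this ⟨h1, h2⟩
        simp [freeInd, h2]
      · simp [h1]
  · have h' := mt hiff.2 h
    push Not at h'
    obtain ⟨y, hy, h1, h2⟩ := h'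
    rw [Finset.prod_eq_zero hy]
    · simp [freeInd, h]
    · simp [freeInd, h1, h2]

variable [Fintype W]

theorem bernExp_selInd (hr : ∀ x, ∀ y ∈ out x, r y < r x) (p : W → ℝ) (x : W) :
    bernExp p (selInd hr x) = p x * bernExp p (freeInd hr x) := by
  rw [← bernExp_coin_mul p (freeInd_dependsOn hr x)]
  exact congrArg _ (funext (selInd_eq hr x))

/-- The coins at out-neighbors of `x` average out of the product formula `freeInd_eq_prod`; the
factors `1 - p y * g y` are then bounded below by exponentials, and Jensen applies. -/
theorem exp_le_bernExp_freeInd (hr : ∀ x, ∀ y ∈ out x, r y < r x) {p : W → ℝ} {P q : ℝ}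
    (h0 : ∀ x, 0 ≤ p x) (hpP : ∀ x, p x ≤ P) (hP : P < 1) (hq : 0 ≤ q) {d : ℕ} (x : W)
    (hd : (out x).card ≤ d)
    (hpar : ∀ y ∈ out x, ∀ z ∈ out x, ∀ n, OutWalk out n y z → Even n)
    (hsel : ∀ y ∈ out x, bernExp p (selInd hr y) = q) :
    Real.exp (-(d * q / (1 - P))) ≤ bernExp p (freeInd hr x) := by
  have h1 : ∀ x, p x ≤ 1 := fun x => (hpP x).trans hP.le
  have hP' : 0 < 1 - P := by linarith
  set g : W → (W → Bool) → ℝ := fun y ω => freeInd hr y (clearCoins (out x) ω) with hg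
  have hg01 : ∀ y ω, g y ω = 0 ∨ g y ω = 1 := by
    intro y ω
    simp only [hg, freeInd]
    split_ifs <;> simp
  have hgdep : ∀ y, DependsOn (g y) (↑(out x) : Set W)ᶜ := by
    intro y ω ω' h
    have : clearCoins (out x) ω = clearCoins (out x) ω' := by
      funext z
      unfold clearCoins
      split_ifs with hz
      · rfl
      · exact h z (by simpa using hz)
    simp only [hg, this]
  have e : bernExp p (freeInd hr x) =
      bernExp p (fun ω => ∏ y ∈ out x, (1 - p y * g y ω)) := by
    have := bernExp_prod_one_sub_coin p (out x) g (fun _ => 1) (fun _ _ _ => rfl)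
      (fun y _ => hgdep y)
    simp only [one_mul] at this
    rw [← this]
    exact congrArg _ (funext (freeInd_eq_prod hr x))
  -- The only use of parity: clearing coins at even walk length cannot create freeness.
  have hle : ∀ y ∈ out x, p y * bernExp p (g y) ≤ q := by
    intro y hy
    rw [← hsel y hy, bernExp_selInd]
    refine mul_le_mul_of_nonneg_left (bernExp_mono h0 h1 fun ω => ?_) (h0 y)
    simp only [hg, freeInd]
    by_cases hf : GreedyFree hr (clearCoins (out x) ω) y
    · rw [if_pos hf, if_pos (greedyFree_of_clearCoins hr _ ω y (hpar y hy) hf)]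
    · rw [if_neg hf]; split_ifs <;> simp
  calc Real.exp (-(d * q / (1 - P)))
      ≤ Real.exp (bernExp p (fun ω => ∑ y ∈ out x, (-(p y / (1 - P))) * g y ω)) := by
        refine Real.exp_le_exp.2 ?_
        rw [bernExp_sum]
        simp only [bernExp_const_mul]
        have : ∑ y ∈ out x, p y * bernExp p (g y) ≤ d * q := by
          calc _ ≤ (out x).card • q := Finset.sum_le_card_nsmul _ _ _ hle
            _ ≤ d * q := by
              rw [nsmul_eq_mul]
              exact mul_le_mul_of_nonneg_right (by exact_mod_cast hd) hq
        have e2 : ∑ y ∈ out x, -(p y / (1 - P)) * bernExp p (g y) =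
            -((∑ y ∈ out x, p y * bernExp p (g y)) / (1 - P)) := by
          rw [Finset.sum_div, ← Finset.sum_neg_distrib]
          exact Finset.sum_congr rfl fun y _ => by ring
        rw [e2]
        gcongr
    _ ≤ bernExp p (fun ω => Real.exp (∑ y ∈ out x, (-(p y / (1 - P))) * g y ω)) :=
        exp_bernExp_le h0 h1 _
    _ ≤ bernExp p (freeInd hr x) := by
        rw [e]
        refine bernExp_mono h0 h1 fun ω => ?_
        rw [Real.exp_sum]
        refine Finset.prod_le_prod (fun y _ => (Real.exp_pos _).le) fun y _ => ?_
        rcases hg01 y ω with h | h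
        · simp [h]
        · rw [h, mul_one, mul_one]
          exact exp_neg_div_le_one_sub (h0 y) (hpP y) hP

/-- The coins can be biased so that every vertex is selected with the same probability `q`. -/
theorem exists_uniform_selection (hr : ∀ x, ∀ y ∈ out x, r y < r x) {P q : ℝ}
    (hP0 : 0 < P) (hP : P < 1) (hq : 0 ≤ q) {d : ℕ} (hqP : q ≤ P * Real.exp (-(d * q / (1 - P))))
    (hd : ∀ x, (out x).card ≤ d)
    (hpar : ∀ x, ∀ y ∈ out x, ∀ z ∈ out x, ∀ n, OutWalk out n y z → Even n) :
    ∃ p : W → ℝ, (∀ x, 0 ≤ p x) ∧ (∀ x, p x ≤ 1) ∧ ∀ x, bernExp p (selInd hr x) = q := by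
  -- Biases are fixed in order of increasing rank, along sets closed under out-neighbors. The bound
  -- `P` rather than 1 is carried along because the freeness estimate needs it.
  suffices H : ∀ A : Finset W, (∀ x ∈ A, ∀ y ∈ out x, y ∈ A) →
      ∃ p : W → ℝ, (∀ x, 0 ≤ p x) ∧ (∀ x, p x ≤ P) ∧ ∀ x ∈ A, bernExp p (selInd hr x) = q by
    obtain ⟨p, h0, h1, h⟩ := H Finset.univ (by simp)
    exact ⟨p, h0, fun x => (h1 x).trans hP.le, fun x => h x (Finset.mem_univ x)⟩
  intro A
  induction A using Finset.induction_on_max_value r with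
  | empty => exact fun _ => ⟨fun _ => 0, by simp, by simp [hP0.le], by simp⟩
  | insert a A ha hmax ih =>
    intro hA
    have hlow : ∀ y ∈ out a, y ∈ A := fun y hy => by
      rcases Finset.mem_insert.1 (hA a (Finset.mem_insert_self a A) y hy) with rfl | h
      · exact absurd (hr y y hy) (lt_irrefl _)
      · exact h
    obtain ⟨p, h0, hpP, h⟩ := ih fun x hx y hy => by
      rcases Finset.mem_insert.1 (hA x (Finset.mem_insert_of_mem hx) y hy) with rfl | h
      · exact absurd (hr x y hy) (not_lt.2 (hmax x hx))
      · exact h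
    set b := bernExp p (freeInd hr a) with hb
    have hbge : Real.exp (-(d * q / (1 - P))) ≤ b :=
      exp_le_bernExp_freeInd hr h0 hpP hP hq a (hd a) (hpar a) fun y hy => h y (hlow y hy)
    have hbpos : 0 < b := (Real.exp_pos _).trans_le hbge
    -- Selection at `a` has probability bias times `b`. The choice `q / b` is at most `P` by `hqP`,
    -- and it disturbs no earlier vertex, since none has a walk to `a`.
    refine ⟨Function.update p a (q / b), fun x => ?_, fun x => ?_, fun x hx => ?_⟩
    · by_cases hxa : x = a
      · subst hxa; rw [Function.update_self]; positivity
      · rw [Function.update_of_ne hxa]; exact h0 x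
    · by_cases hxa : x = a
      · subst hxa
        rw [Function.update_self, div_le_iff₀ hbpos]
        exact hqP.trans (mul_le_mul_of_nonneg_left hbge hP0.le)
      · rw [Function.update_of_ne hxa]; exact hpP x
    · rcases Finset.mem_insert.1 hx with rfl | hxA
      · rw [bernExp_selInd, Function.update_self, bernExp_update p (freeInd_dependsOn hr x), ← hb]
        field_simp
      · rw [bernExp_update p _ _, h x hxA]
        refine (selInd_dependsOn hr x).mono ?_
        rintro y ⟨n, hw⟩ rfl
        rcases n with _ | n
        · obtain rfl : x = y := hw
          exact ha hxA
        · have := hw.length_add_rank_le hr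
          have := hmax x hxA
          omega

end GreedySelection
-- Dependency balls, ranks, and lifting the orientation to a cover
/-- The vertices reached from `x` in `m` steps, each leading from a vertex `z` into `N z`. -/
def stepBall {W : Type*} [DecidableEq W] (N : W → Finset W) : ℕ → W → Finset W
  | 0, x => {x}
  | m + 1, x => (stepBall N m x).biUnion N

theorem card_stepBall_le {W : Type*} [DecidableEq W] {N : W → Finset W} {c : ℕ}
    (hc : ∀ x, (N x).card ≤ c) (m : ℕ) (x : W) : (stepBall N m x).card ≤ c ^ m := by
  induction m with
  | zero => simp [stepBall]
  | succ m ih =>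
    rw [pow_succ]
    exact (Finset.card_biUnion_le_card_mul _ _ c fun z _ => hc z).trans
      (Nat.mul_le_mul_right c ih)

theorem stepBall_mono {W : Type*} [DecidableEq W] {N : W → Finset W} (hN : ∀ x, x ∈ N x)
    {m n : ℕ} (hmn : m ≤ n) (x : W) : stepBall N m x ⊆ stepBall N n x := by
  induction n, hmn using Nat.le_induction with
  | base => exact subset_rfl
  | succ n _ ih => exact fun z hz => Finset.mem_biUnion.2 ⟨z, ih hz, hN z⟩

theorem OutWalk.mem_stepBall {W : Type*} [DecidableEq W] {out N : W → Finset W}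
    (hN : ∀ x, ∀ y ∈ out x, y ∈ N x) {n : ℕ} {a x y : W} {m : ℕ} (ha : x ∈ stepBall N m a)
    (h : OutWalk out n x y) : y ∈ stepBall N (m + n) a := by
  induction n generalizing x m with
  | zero => obtain rfl : x = y := h; exact ha
  | succ n ih =>
    obtain ⟨z, hz, hw⟩ := h
    have := ih (m := m + 1) (Finset.mem_biUnion.2 ⟨x, ha, hN x z hz⟩) hw
    rwa [show m + (n + 1) = m + 1 + n by ring]

theorem OutWalk.mem_stepBall_reverse {W : Type*} [DecidableEq W] {out N : W → Finset W}
    (hN : ∀ x, ∀ y ∈ out x, x ∈ N y) {n : ℕ} {a x y : W} {m : ℕ} (ha : y ∈ stepBall N m a)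
    (h : OutWalk out n x y) : x ∈ stepBall N (m + n) a := by
  induction n generalizing x with
  | zero => obtain rfl : x = y := h; exact ha
  | succ n ih =>
    obtain ⟨z, hz, hw⟩ := h
    exact Finset.mem_biUnion.2 ⟨z, ih hw, hN x z hz⟩

/-- The rank counts reachable vertices. Its bound by `|V|` limits the length of walks, hence the
range of dependence. -/
theorem Digraph.IsAcyclic.exists_rank {V : Type*} [Finite V] {D : Digraph V} (hD : D.IsAcyclic) :
    ∃ r : V → ℕ, (∀ v w, D.Adj v w → r w < r v) ∧ ∀ v, r v ≤ Nat.card V := by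
  refine ⟨fun v => {w | Relation.TransGen D.Adj v w}.ncard, fun v w h => ?_, fun v => ?_⟩
  · refine Set.ncard_lt_ncard ⟨fun z hz => Relation.TransGen.head h hz, fun hs => ?_⟩
      (Set.toFinite _)
    exact hD w (hs (Relation.TransGen.single h))
  · rw [← Set.ncard_univ]
    exact Set.ncard_le_ncard (Set.subset_univ _) (Set.toFinite _)

/-- Rank strictly decreases along a walk, so no vertex repeats. -/
theorem Digraph.hasDirectedPath_of_chain {V : Type*} {D : Digraph V} {r : V → ℕ}
    (hr : ∀ v w, D.Adj v w → r w < r v) {n : ℕ} (p : Fin (n + 1) → V)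
    (hp : ∀ i : Fin n, D.Adj (p i.castSucc) (p i.succ)) :
    D.HasDirectedPath (p 0) (p (Fin.last n)) n := by
  have h : StrictAnti (r ∘ p) := Fin.strictAnti_iff_succ_lt.2 fun i => hr _ _ (hp i)
  exact ⟨p, h.injective.of_comp, rfl, rfl, hp⟩

namespace DPCover

variable {V W : Type u} {G : SimpleGraph V}

/-- The vertex of `G` whose list contains `x`. -/
noncomputable def proj (C : DPCover G W) (x : W) : V :=
  (C.partition x).choose

theorem mem_L_iff (C : DPCover G W) {x : W} {v : V} : x ∈ C.L v ↔ C.proj x = v := by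
  have h := (C.partition x).choose_spec
  exact ⟨fun hx => (h.2 v hx).symm, fun hv => hv ▸ h.1⟩

theorem mem_L_proj (C : DPCover G W) (x : W) : x ∈ C.L (C.proj x) :=
  C.mem_L_iff.2 rfl

open Classical in
/-- The out-neighbors of `x` in the orientation of the cross-edges lifted from `D`. -/
noncomputable def outNbrs [Fintype W] (C : DPCover G W) (D : Digraph V) (x : W) : Finset W :=
  {y | C.H.Adj x y ∧ D.Adj (C.proj x) (C.proj y)}

theorem mem_outNbrs [Fintype W] (C : DPCover G W) (D : Digraph V) {x y : W} :
    y ∈ C.outNbrs D x ↔ C.H.Adj x y ∧ D.Adj (C.proj x) (C.proj y) := by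
  simp [outNbrs]

theorem exists_chain_of_outWalk [Fintype W] (C : DPCover G W) (D : Digraph V) {n : ℕ} {x y : W}
    (h : OutWalk (C.outNbrs D) n x y) :
    ∃ p : Fin (n + 1) → V, p 0 = C.proj x ∧ p (Fin.last n) = C.proj y ∧
      ∀ i : Fin n, D.Adj (p i.castSucc) (p i.succ) := by
  induction n generalizing x with
  | zero => obtain rfl : x = y := h; exact ⟨fun _ => C.proj x, rfl, rfl, fun i => i.elim0⟩
  | succ n ih =>
    obtain ⟨z, hz, hw⟩ := h
    obtain ⟨p, hp0, hpl, hp⟩ := ih hw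
    refine ⟨Fin.cons (C.proj x) p, rfl, ?_, fun i => ?_⟩
    · rw [← Fin.succ_last, Fin.cons_succ, hpl]
    · refine Fin.cases ?_ (fun j => ?_) i
      · rw [Fin.castSucc_zero, Fin.cons_zero, Fin.cons_succ, hp0]
        exact ((C.mem_outNbrs D).1 hz).2
      · rw [Fin.castSucc_succ, Fin.cons_succ, Fin.cons_succ]
        exact hp j

end DPCover

/-! ### Concentration of the selection in all lists -/

theorem exists_isColoring_of_large_fold {V : Type u} [Finite V] {G : SimpleGraph V}
    {D : Digraph V} (hor : D.IsOrientationOf G) (hac : D.IsAcyclic) {d : ℕ}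
    (hd : ∀ v : V, {w : V | D.Adj v w}.ncard ≤ d)
    (hpath : ∀ v w : V, D.Adj v w → ∀ n : ℕ, Even n → ¬ D.HasDirectedPath v w n)
    {P q η : ℝ} (hP0 : 0 < P) (hP : P < 1) (hq0 : 0 ≤ q) (hq1 : q ≤ 1)
    (hqP : q ≤ P * Real.exp (-(d * q / (1 - P)))) (hη : η < q) :
    ∃ k : ℕ, 1 ≤ k ∧ ∀ (W : Type u) [Finite W] (C : DPCover G W), C.IsFold k →
      ∃ S : Set W, C.IsColoring η S := by
  classical
  have := Fintype.ofFinite V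
  obtain ⟨r, hr, hrn⟩ := hac.exists_rank
  set n := Nat.card V with hn
  -- Correlated vertices are joined by a walk down and a walk back up, each of at most `n` steps,
  -- with at most `n` choices per step.
  set M := n ^ (n + n) with hM
  obtain ⟨k, hk⟩ := exists_nat_gt ((n * M : ℝ) / (q - η) ^ 2)
  have hqη : 0 < q - η := by linarith
  have hk0 : (0 : ℝ) < k := lt_of_le_of_lt (by positivity) hk
  refine ⟨k, by exact_mod_cast hk0, fun W _ C hfold => ?_⟩
  have := Fintype.ofFinite W
  have hGD : ∀ {v w}, D.Adj v w → G.Adj v w := fun h => (hor.1 _ _).2 (Or.inl h)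
  set out := C.outNbrs D with hout
  have hrW : ∀ x, ∀ y ∈ out x, r (C.proj y) < r (C.proj x) := fun x y hy =>
    hr _ _ ((C.mem_outNbrs D).1 hy).2
  have huniq : ∀ x y z, G.Adj (C.proj x) (C.proj y) → C.proj y = C.proj z → C.H.Adj x y →
      C.H.Adj x z → y = z := fun x y z hG hyz h1 h2 =>
    C.matching _ _ hG x (C.mem_L_proj x) y (C.mem_L_proj y) z (C.mem_L_iff.2 hyz.symm) h1 h2
  have hcard : ∀ x, (out x).card ≤ d := by
    intro x
    refine le_trans ?_ (hd (C.proj x))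
    rw [← Set.ncard_coe_finset]
    refine Set.ncard_le_ncard_of_injOn C.proj (fun y hy => ?_) (fun y hy z hz hyz => ?_)
      (Set.toFinite _)
    · exact ((C.mem_outNbrs D).1 hy).2
    · have hy' := (C.mem_outNbrs D).1 hy
      exact huniq x y z (hGD hy'.2) hyz hy'.1 ((C.mem_outNbrs D).1 hz).1
  have hpar : ∀ x, ∀ y ∈ out x, ∀ z ∈ out x, ∀ m, OutWalk out m y z → Even m := by
    intro x y hy z hz m hw
    by_contra hm
    -- An odd walk from `y` to `z`, preceded by the arc from `x` to `y`, would project to an even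
    -- path parallel to an arc.
    obtain ⟨p, hp0, hpl, hp⟩ := C.exists_chain_of_outWalk D
      (show OutWalk (C.outNbrs D) (m + 1) x z from ⟨y, hy, hw⟩)
    have := Digraph.hasDirectedPath_of_chain hr p hp
    rw [hp0, hpl] at this
    exact hpath _ _ ((C.mem_outNbrs D).1 hz).2 (m + 1) (Nat.even_add_one.2 hm) this
  obtain ⟨p, hp0, hp1, hp⟩ := exists_uniform_selection hrW hP0 hP hq0 hqP hcard hpar
  set N : W → Finset W := fun x => {y | y = x ∨ y ∈ out x ∨ x ∈ out y} with hN
  have hNcross : ∀ x y, y ∈ out x ∨ x ∈ out y → C.H.Adj x y ∧ G.Adj (C.proj x) (C.proj y) := by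
    rintro x y (h | h)
    · exact ((C.mem_outNbrs D).1 h).imp_right hGD
    · exact ((C.mem_outNbrs D).1 h).imp (fun h => h.symm) fun h => (hGD h).symm
  have hNcard : ∀ x, (N x).card ≤ n := by
    intro x
    rw [hn, Nat.card_eq_fintype_card, ← Finset.card_univ]
    refine Finset.card_le_card_of_injOn C.proj (fun _ _ => Finset.mem_univ _)
      (fun y hy z hz hyz => ?_)
    simp only [hN, Finset.coe_filter, Finset.mem_univ, true_and, Set.mem_ofPred_eq] at hy hz
    rcases hy with rfl | hy <;> rcases hz with rfl | hz
    · rfl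
    · exact absurd hyz (hNcross _ _ hz).2.ne
    · exact absurd hyz (hNcross _ _ hy).2.ne'
    · exact huniq x y z (hNcross _ _ hy).2 hyz (hNcross _ _ hy).1 (hNcross _ _ hz).1
  have hNself : ∀ x, x ∈ N x := fun x => by simp [hN]
  have hindep : ∀ x y, y ∉ stepBall N (n + n) x →
      bernExp p (fun ω => selInd hrW x ω * selInd hrW y ω) = q * q := by
    intro x y hxy
    -- The coins are split into those reachable from `x` and the rest; a coin reachable from both
    -- `x` and `y` would put `y` in the ball.
    rw [bernExp_mul_of_dependsOn p ({z | ∃ m, OutWalk out m x z} : Finset W), hp x, hp y]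
    · exact (selInd_dependsOn hrW x).mono (by simp)
    · refine (selInd_dependsOn hrW y).mono ?_
      rintro z ⟨m, hm⟩ hz
      obtain ⟨l, hl⟩ : ∃ l, OutWalk out l x z := by simpa using hz
      have h1 := hl.mem_stepBall (N := N) (fun x y hy => by simp [hN, hy]) (a := x) (m := 0)
        (by simp [stepBall])
      have h2 := hm.mem_stepBall_reverse (N := N) (fun x y hy => by simp [hN, hy]) h1
      have h3 := hl.length_add_rank_le hrW
      have h4 := hm.length_add_rank_le hrW
      have h5 := hrn (C.proj x)
      have h6 := hrn (C.proj y)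
      exact hxy (stepBall_mono hNself (by omega) x h2)
  set Lf : V → Finset W := fun v => {x | x ∈ C.L v} with hLf
  have hLfcoe : ∀ v, (Lf v : Set W) = C.L v := fun v => by simp [hLf]
  have hLfcard : ∀ v, (Lf v).card = k := fun v => by
    rw [← Set.ncard_coe_finset, hLfcoe, hfold v]
  have hvar : ∀ v, bernExp p (fun ω => (∑ x ∈ Lf v, selInd hrW x ω - k * q) ^ 2) ≤ k * M := by
    intro v
    have := bernExp_sq_sum_sub_le hp0 hp1 (Lf v) (selInd hrW) hq0 hq1
      (fun x ω => by unfold selInd; split_ifs <;> simp)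
      (fun x ω => by unfold selInd; split_ifs <;> simp) (fun x _ => hp x)
      (stepBall N (n + n)) (M := M) (fun x _ => card_stepBall_le hNcard _ x)
      (fun x _ y _ => hindep x y)
    rwa [hLfcard v] at this
  -- Summing the squared deviations over all lists replaces a union bound: an outcome with small
  -- total is good for each list.
  have htotal : bernExp p (fun ω => ∑ v, (∑ x ∈ Lf v, selInd hrW x ω - k * q) ^ 2) <
      ((q - η) * k) ^ 2 := by
    rw [bernExp_sum]
    calc _ ≤ (Finset.univ : Finset V).card • ((k : ℝ) * M) :=
          Finset.sum_le_card_nsmul _ _ _ fun v _ => hvar v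
      _ = n * M * k := by
          rw [Finset.card_univ, ← Nat.card_eq_fintype_card, ← hn, nsmul_eq_mul]; ring
      _ < ((q - η) * k) ^ 2 := by
          rw [div_lt_iff₀ (by positivity)] at hk
          calc (n * M * k : ℝ) < k * (q - η) ^ 2 * k := by gcongr
            _ = _ := by ring
  obtain ⟨ω, hω⟩ := exists_lt_of_bernExp_lt hp0 hp1 htotal
  refine ⟨{x | GreedySelected hrW ω x}, ?_, fun v => ?_⟩
  · rintro v w hvw x ⟨hx, hxv⟩ y ⟨hy, hyw⟩ hadj
    have hG := (C.edge_over v w x hxv y hyw hadj).resolve_left hvw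
    rw [C.mem_L_iff] at hxv hyw
    subst hxv hyw
    rcases (hor.1 _ _).1 hG with h | h
    · exact ((greedySelected_iff hrW ω x).1 hx).2 y ((C.mem_outNbrs D).2 ⟨hadj, h⟩) hy
    · exact ((greedySelected_iff hrW ω y).1 hy).2 x ((C.mem_outNbrs D).2 ⟨hadj.symm, h⟩) hx
  · have hsq : (∑ x ∈ Lf v, selInd hrW x ω - k * q) ^ 2 < ((q - η) * k) ^ 2 :=
      lt_of_le_of_lt (Finset.single_le_sum
        (f := fun v => (∑ x ∈ Lf v, selInd hrW x ω - k * q) ^ 2)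
        (fun v _ => sq_nonneg _) (Finset.mem_univ v)) hω
    have habs := (abs_lt.1 (abs_lt_of_sq_lt_sq hsq (by positivity))).1
    have hsum : ∑ x ∈ Lf v, selInd hrW x ω =
        (({x | GreedySelected hrW ω x} ∩ C.L v : Set W).ncard : ℝ) := by
      have : ({x | GreedySelected hrW ω x} ∩ C.L v : Set W) =
          ↑((Lf v).filter fun x => GreedySelected hrW ω x) := by
        ext x
        simp [hLf, and_comm]
      rw [this, Set.ncard_coe_finset, Finset.card_filter, Nat.cast_sum]
      exact Finset.sum_congr rfl fun x _ => by simp [selInd]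
    rw [hfold v, ← hsum]
    linarith
-- Choice of parameters and the final error function
/-- The number `c` bounds the fractional DP-chromatic number of all graphs with an acyclic
orientation of maximum out-degree at most `d` in which no arc is parallel to a directed path of even
length. -/
def FracDPBound (d : ℕ) (c : ℝ) : Prop :=
  ∀ (V : Type u) [Finite V] (G : SimpleGraph V) (D : Digraph V),
    D.IsOrientationOf G → D.IsAcyclic → (∀ v : V, {w : V | D.Adj v w}.ncard ≤ d) →
    (∀ v w : V, D.Adj v w → ∀ n : ℕ, Even n → ¬ D.HasDirectedPath v w n) →
    fracDPChromaticNumber G ≤ ENNReal.ofReal c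

theorem FracDPBound.mono {d : ℕ} {b c : ℝ} (h : FracDPBound.{u} d b) (hbc : b ≤ c) :
    FracDPBound.{u} d c := fun V _ G D h1 h2 h3 h4 =>
  (h V G D h1 h2 h3 h4).trans (ENNReal.ofReal_le_ofReal hbc)

theorem fracDPBound_inv {d : ℕ} {P q η : ℝ} (hP0 : 0 < P) (hP : P < 1)
    (hqP : q ≤ P * Real.exp (-(d * q / (1 - P)))) (hη0 : 0 < η) (hη : η < q) :
    FracDPBound.{u} d η⁻¹ := by
  intro V _ G D hor hac hd hpath
  have hq0 : 0 ≤ q := (hη0.trans hη).le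
  have hP' : 0 < 1 - P := by linarith
  have hq1 : q ≤ 1 := by
    refine hqP.trans (mul_le_one₀ hP.le (Real.exp_pos _).le (Real.exp_le_one_iff.2 ?_))
    have : 0 ≤ d * q / (1 - P) := by positivity
    linarith
  obtain ⟨k, hk, hcol⟩ :=
    exists_isColoring_of_large_fold hor hac hd hpath hP0 hP hq0 hq1 hqP hη
  have hθ : η ≤ thetaDP G k :=
    (isGreatest_thetaDP G k).2 ⟨⟨hη0.le, by linarith⟩, hcol⟩
  calc fracDPChromaticNumber G ≤ (ENNReal.ofReal (thetaDP G k))⁻¹ := iInf₂_le k hk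
    _ ≤ (ENNReal.ofReal η)⁻¹ := ENNReal.inv_le_inv.2 (ENNReal.ofReal_le_ofReal hθ)
    _ = ENNReal.ofReal η⁻¹ := (ENNReal.ofReal_inv_of_pos hη0).symm

theorem eventually_fracDPBound {e : ℝ} (he : 0 < e) :
    ∀ᶠ d : ℕ in atTop, FracDPBound.{u} d ((1 + e) * ((d : ℝ) / Real.log d)) := by
  -- This makes `1 - s` the midpoint of `1` and `(1 + e)⁻¹`, so `q = (1 - s) * (L / d)` strictly
  -- exceeds the target ratio.
  set s : ℝ := e / (2 * (1 + e)) with hs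
  have hs0 : 0 < s := by positivity
  have hs1 : s < 1 := by rw [hs, div_lt_one (by positivity)]; linarith
  have hlog : Tendsto (fun d : ℕ => Real.log d) atTop atTop :=
    Real.tendsto_log_atTop.comp tendsto_natCast_atTop_atTop
  -- The threshold is what `L ≤ s / 2 * ((s / 2 * L) ^ 2 / 2)` requires.
  filter_upwards [hlog.eventually_ge_atTop (16 / s ^ 3), eventually_ge_atTop 2] with d hL hd2
  have hd : (0 : ℝ) < d := by positivity
  set L := Real.log d with hLdef
  have hL0 : 0 < L := lt_of_lt_of_le (by positivity) hL
  have hinv : (1 + e) * ((d : ℝ) / L) = ((1 + e)⁻¹ * (L / d))⁻¹ := by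
    rw [mul_inv, inv_inv, inv_div]
  rw [hinv]
  refine fracDPBound_inv (P := s / 2) (q := (1 - s) * (L / d)) (by positivity) (by linarith) ?_
    (by positivity) ?_
  · have hexp : Real.exp (-L) * Real.exp (s / 2 * L) ≤
        Real.exp (-(d * ((1 - s) * (L / d)) / (1 - s / 2))) := by
      rw [← Real.exp_add]
      refine Real.exp_le_exp.2 ?_
      have e1 : (d : ℝ) * ((1 - s) * (L / d)) / (1 - s / 2) = (1 - s) / (1 - s / 2) * L := by
        field_simp
      have e2 : (1 - s) / (1 - s / 2) ≤ 1 - s / 2 := by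
        rw [div_le_iff₀ (by linarith)]
        nlinarith [sq_nonneg s]
      rw [e1]
      nlinarith [mul_le_mul_of_nonneg_right e2 hL0.le]
    have hquad : L ≤ s / 2 * Real.exp (s / 2 * L) := by
      have h1 := Real.quadratic_le_exp_of_nonneg (show 0 ≤ s / 2 * L by positivity)
      have h2 : (s / 2 * L) ^ 2 / 2 ≤ Real.exp (s / 2 * L) := by
        have : 0 ≤ s / 2 * L := by positivity
        linarith
      rw [div_le_iff₀ (by positivity)] at hL
      calc L ≤ s / 2 * ((s / 2 * L) ^ 2 / 2) := by nlinarith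
        _ ≤ _ := by gcongr
    have hdinv : Real.exp (-L) = 1 / d := by
      rw [Real.exp_neg, hLdef, Real.exp_log hd, one_div]
    calc (1 - s) * (L / d) ≤ L / d := mul_le_of_le_one_left (by positivity) (by linarith)
      _ ≤ s / 2 * Real.exp (s / 2 * L) / d := by gcongr
      _ = s / 2 * (Real.exp (-L) * Real.exp (s / 2 * L)) := by rw [hdinv]; ring
      _ ≤ _ := by gcongr
  · refine mul_lt_mul_of_pos_right ?_ (by positivity)
    rw [inv_lt_iff_one_lt_mul₀ (by positivity), hs]
    field_simp
    linarith

theorem exists_fracDPBound {d : ℕ} (hd : 2 ≤ d) :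
    ∃ e : ℝ, 0 ≤ e ∧ FracDPBound.{u} d ((1 + e) * ((d : ℝ) / Real.log d)) := by
  have hd2 : (2 : ℝ) ≤ d := by exact_mod_cast hd
  have hL : 0 < Real.log d := Real.log_pos (by linarith)
  have hd0 : (0 : ℝ) < d := by linarith
  -- A crude bound `16 * d`, valid for every `d ≥ 2`, ensures that some finite error always exists.
  refine ⟨16 * Real.log d, by positivity, ?_⟩
  have h : FracDPBound.{u} d (1 / (16 * (d : ℝ)))⁻¹ := by
    refine fracDPBound_inv (P := 1 / 2) (q := 1 / (8 * d)) (by norm_num) (by norm_num) ?_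
      (by positivity) ?_
    · have e1 : (d : ℝ) * (1 / (8 * d)) / (1 - 1 / 2) = 1 / 4 := by field_simp; norm_num
      rw [e1]
      have h1 := Real.add_one_le_exp (-(1 / 4 : ℝ))
      have h2 : 1 / (8 * (d : ℝ)) ≤ 1 / 16 := by gcongr; linarith
      linarith
    · gcongr; norm_num
  refine h.mono ?_
  rw [one_div, inv_inv]
  have : (1 + 16 * Real.log d) * ((d : ℝ) / Real.log d) = d / Real.log d + 16 * d := by
    field_simp
  rw [this]
  have : 0 ≤ (d : ℝ) / Real.log d := by positivity
  linarith

theorem theorem1p6 :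
    ∃ ε : ℕ → ℝ, Tendsto ε atTop (𝓝 0) ∧
      ∀ d : ℕ, 2 ≤ d →
        ∀ (V : Type u) [Finite V] (G : SimpleGraph V) (D : Digraph V),
          D.IsOrientationOf G →
          D.IsAcyclic →
          (∀ v : V, {w : V | D.Adj v w}.ncard ≤ d) →
          (∀ v w : V, D.Adj v w → ∀ n : ℕ, Even n → ¬ D.HasDirectedPath v w n) →
          fracDPChromaticNumber G ≤
            ENNReal.ofReal ((1 + ε d) * ((d : ℝ) / Real.log (d : ℝ))) := by
  set A : ℕ → Set ℝ := fun d =>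
    {e | 0 ≤ e ∧ FracDPBound.{u} d ((1 + e) * ((d : ℝ) / Real.log d))} with hA
  have hbdd : ∀ d, BddBelow (A d) := fun d => ⟨0, fun e he => he.1⟩
  have hnonneg : ∀ d, 0 ≤ sInf (A d) := fun d => Real.sInf_nonneg fun e he => he.1
  -- The vanishing positive slack removes the need for the infimum to be attained.
  refine ⟨fun d => sInf (A d) + 1 / ((d : ℝ) + 1), ?_, ?_⟩
  · have h : Tendsto (fun d => sInf (A d)) atTop (𝓝 0) := by
      rw [Metric.tendsto_nhds]
      intro c hc
      filter_upwards [eventually_fracDPBound.{u} (half_pos hc)] with d hd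
      rw [Real.dist_eq, sub_zero, abs_of_nonneg (hnonneg d)]
      have : sInf (A d) ≤ c / 2 := csInf_le (hbdd d) ⟨(half_pos hc).le, hd⟩
      linarith
    simpa using h.add tendsto_one_div_add_atTop_nhds_zero_nat
  · intro d hd
    have hne : (A d).Nonempty := exists_fracDPBound hd
    obtain ⟨e, he, hlt⟩ := exists_lt_of_csInf_lt hne
      (show sInf (A d) < sInf (A d) + 1 / ((d : ℝ) + 1) by
        have : (0 : ℝ) < 1 / ((d : ℝ) + 1) := by positivity
        linarith)
    have hlog : 0 ≤ Real.log (d : ℝ) := Real.log_natCast_nonneg d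
    exact he.2.mono (by gcongr)
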